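/- Let $p$ be a prime, let $k\ge 1$ be an integer, and let $G$ be a nontrivial nilpotent $p$-group of class at most $k$, that is, $G_{k+1}=\{e\}$, where $G_1=G$ and $G_{n+1}=[G_n,G]$. Let $x_1,\dots,x_r$ generate $G$, where $x_i$ has order $p^{\alpha_i}$ and $\alpha_1\le\alpha_2\le\cdots\le\alpha_r$. If $G$ is capable, i.e. if there is a group $H$ with $G\cong H/Z(H)$, then $r>1$ and \[\alpha_r\le \alpha_{r-1}+\left\lfloor\frac{k-1}{p-1}\right\rfloor .\] In particular, if $k<p$, then $\alpha_r=\alpha_{r-1}$. -/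

import Mathlib

universe u v

/-- A group `G` is capable if it is isomorphic to the central quotient `H / Z(H)` of some
group `H`. The universe of the witness `H` is independent of that of `G`. -/
def IsCapableGroup (G : Type u) [Group G] : Prop :=
  ∃ (H : Type v) (_ : Group H), Nonempty (G ≃* H ⧸ Subgroup.center H)

/-!
Let `G ≅ H / Z(H)`, so that `H` has class at most `k + 1`, and let `h i` lift the generators.
A power `z` of the last lift lies in `Z(H)` as soon as it commutes with every other lift
(`mem_center_of_commute_lifts`), and then the order of the last generator divides the exponent.
So the theorem reduces to `commute_pow_of_pow_mem_center`: if `y ^ p ^ a` is central in `H`, then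
`x ^ p ^ (a + (k - 1) / (p - 1))` commutes with `y`, applied with `a` the second largest exponent.

Let `Y` be the normal closure of `y` and `⁅Y, j H⁆ = ⁅Y, H, …, H⁆` with `j` entries `H`, which is
trivial for `j = k + 1`. The heart of the matter is that for `j ≥ 1` the elements of `⁅Y, j H⁆`
have order dividing `p ^ (a + (k - j) / (p - 1))` (`pow_eq_one_of_mem_iteratedCommutator`).
If `m` is a commutator of `y` with `j` further elements, consider the same commutator formed with
`y ^ n`, as a function `g` of `n`. It is a polynomial sequence, that is, a product of factors
`c i ^ n.choose i` with `c i ∈ ⁅Y, j + i - 1 H⁆` and `c 1 = m`. At `n = N := p ^ (a + ⋯)` the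
power `y ^ N` is central, so `g N = 1`; by downward induction on `j` the factors with `i ≥ 2`
vanish, because `i - 1` is at least `p - 1` times the `p`-adic valuation of `i`
(`pow_choose_eq_one`). What remains is `m ^ N = 1`. Polynomial sequences form a group, so the same
works for products of commutators. Once the orders are known, the polynomial sequence `⁅y, x ^ n⁆`
is trivial at `N = p ^ (a + (k - 1) / (p - 1))` for the same reason.

The product formula is a form of the Hall–Petrescu identity (`polySeq_apply_eq_pow`). Instead of
collecting commutators, it is obtained from functions on the cube of subsets of a finite set: there
binomial exponents become indicators of faces, the commutator of two generators is again a generator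
(`cubeBox_conj`), and the coefficients are read off at the corners (`cubeGroup_corner_mem`).
-/

open scoped commutatorElement

/-! ### Groups of functions on a cube -/

section Cube

variable {H : Type*} [Group H] {ι : Type*} [DecidableEq ι]

/-- The function on subsets of `ι` with value `a` on the supersets of `S` and `1` elsewhere. -/
def cubeBox (S : Finset ι) (a : H) : Finset ι → H := fun T => if S ⊆ T then a else 1

/-- The Host–Kra group of the sequence `D` of subgroups: the group of functions on the cube of
subsets of `ι` generated by the functions which are constantly `a ∈ D (card S)` on the face of
supersets of `S`, and `1` off that face. -/
def cubeGroup (ι : Type*) [DecidableEq ι] (D : ℕ → Subgroup H) : Subgroup (Finset ι → H) :=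
  Subgroup.closure {f | ∃ S : Finset ι, ∃ a ∈ D S.card, f = cubeBox S a}

theorem cubeBox_mem {D : ℕ → Subgroup H} {S : Finset ι} {a : H} (ha : a ∈ D S.card) :
    cubeBox S a ∈ cubeGroup ι D :=
  Subgroup.subset_closure ⟨S, a, ha, rfl⟩

theorem cubeBox_inv (S : Finset ι) (a : H) : (cubeBox S a)⁻¹ = cubeBox S a⁻¹ := by
  ext T
  by_cases h : S ⊆ T <;> simp [cubeBox, h]

/-- Faces intersect in faces, so the commutator of two generators is again a generator. -/
theorem cubeBox_conj (S T : Finset ι) (a b : H) :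
    cubeBox S a * cubeBox T b * (cubeBox S a)⁻¹ = cubeBox (S ∪ T) ⁅a, b⁆ * cubeBox T b := by
  ext U
  by_cases h : S ⊆ U <;> by_cases h' : T ⊆ U <;>
    simp [cubeBox, h, h', Finset.union_subset_iff, commutatorElement_def]

/-- The group attached to `A` normalises the one attached to `D` when `⁅A i, D j⁆ ≤ D (i + j)`. -/
theorem cubeGroup_conj_mem {A D : ℕ → Subgroup H} (hD : Antitone D)
    (hAD : ∀ i j, ⁅A i, D j⁆ ≤ D (i + j)) {f g : Finset ι → H} (hf : f ∈ cubeGroup ι A)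
    (hg : g ∈ cubeGroup ι D) : f * g * f⁻¹ ∈ cubeGroup ι D := by
  have key : ∀ S : Finset ι, ∀ a ∈ A S.card, ∀ g ∈ cubeGroup ι D,
      cubeBox S a * g * (cubeBox S a)⁻¹ ∈ cubeGroup ι D := by
    intro S a ha g hg
    induction hg using Subgroup.closure_induction with
    | mem g hg =>
      obtain ⟨T, b, hb, rfl⟩ := hg
      rw [cubeBox_conj]
      exact mul_mem (cubeBox_mem (hD (Finset.card_union_le S T)
        (hAD _ _ (Subgroup.commutator_mem_commutator ha hb)))) (cubeBox_mem hb)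
    | one => simp
    | mul x y _ _ hx hy =>
      rw [conj_mul.symm]
      exact mul_mem hx hy
    | inv x _ hx =>
      rw [← conj_inv]
      exact inv_mem hx
  induction hf using Subgroup.closure_induction generalizing g with
  | mem f hf =>
    obtain ⟨S, a, ha, rfl⟩ := hf
    exact key S a ha g hg
  | one => simpa using hg
  | mul x y _ _ hx hy =>
    have := hx (hy hg)
    simpa [mul_assoc] using this
  | inv x hx' hx =>
    have hle : cubeGroup ι A ≤ Subgroup.normalizer (cubeGroup ι D : Set (Finset ι → H)) := by
      refine (Subgroup.closure_le _).2 ?_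
      rintro _ ⟨S, a, ha, rfl⟩
      refine Subgroup.mem_normalizer_iff.2 fun g => ⟨key S a ha g, fun h => ?_⟩
      have := key S a⁻¹ (inv_mem ha) _ h
      rw [← cubeBox_inv] at this
      simpa [mul_assoc] using this
    have := (Subgroup.mem_normalizer_iff.1 (inv_mem (hle hx')) g).1 hg
    exact this

/-- The derivative of `f` in the direction `e` lies in the group of the shifted sequence. -/
theorem cubeGroup_deriv_mem {D : ℕ → Subgroup H} (hD : Antitone D)
    (hDD : ∀ i j, ⁅D i, D j⁆ ≤ D (i + j)) (e : ι) {f : Finset ι → H} (hf : f ∈ cubeGroup ι D) :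
    (fun T => f (T.erase e)) ∈ cubeGroup ι D ∧
      (fun T => (f (T.erase e))⁻¹ * f (insert e T)) ∈ cubeGroup ι fun i => D (i + 1) := by
  have hconj : ∀ {f g : Finset ι → H}, f ∈ cubeGroup ι D → (g ∈ cubeGroup ι fun i => D (i + 1)) →
      f * g * f⁻¹ ∈ cubeGroup ι fun i => D (i + 1) :=
    fun hf hg => cubeGroup_conj_mem (fun i j h => hD (by simpa using h)) (fun i j => hDD i (j + 1))
      hf hg
  induction hf using Subgroup.closure_induction with
  | mem f hf =>
    obtain ⟨S, a, ha, rfl⟩ := hf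
    by_cases he : e ∈ S
    · have h1 : ∀ T : Finset ι, ¬ S ⊆ T.erase e := fun T h => by simpa using h he
      have h2 : ∀ T : Finset ι, S ⊆ insert e T ↔ S.erase e ⊆ T := fun T =>
        Finset.subset_insert_iff
      constructor
      · convert one_mem (cubeGroup ι D) using 1
        ext T
        simp [cubeBox, h1]
      · convert cubeBox_mem (D := fun i => D (i + 1)) (S := S.erase e) (a := a) ?_ using 1
        · ext T
          simp [cubeBox, h1, h2]
        · rwa [Finset.card_erase_add_one he]
    · have h1 : ∀ T : Finset ι, S ⊆ T.erase e ↔ S ⊆ T := fun T => by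
        simp [Finset.subset_erase, he]
      have h2 : ∀ T : Finset ι, S ⊆ insert e T ↔ S ⊆ T := fun T =>
        Finset.subset_insert_iff_of_notMem he
      constructor
      · convert cubeBox_mem ha using 1
        ext T
        simp [cubeBox, h1]
      · convert one_mem (cubeGroup ι fun i => D (i + 1)) using 1
        ext T
        by_cases hS : S ⊆ T <;> simp [cubeBox, h1, h2, hS]
  | one =>
    constructor
    · exact one_mem _
    · convert one_mem (cubeGroup ι fun i => D (i + 1)) using 1
      ext T
      simp
  | mul x y _ _ hx hy =>
    refine ⟨mul_mem hx.1 hy.1, ?_⟩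
    convert mul_mem (hconj (inv_mem hy.1) hx.2) hy.2 using 1
    ext T
    simp [mul_assoc]
  | inv x _ hx =>
    refine ⟨inv_mem hx.1, ?_⟩
    convert hconj hx.1 (inv_mem hx.2) using 1
    ext T
    simp [mul_assoc]

/-- If `f` is trivial on the proper subsets of `S` then its value at `S` is a Taylor coefficient
of degree `card S`, and so lies in `D (card S)`. -/
theorem cubeGroup_corner_mem {D : ℕ → Subgroup H} (hD : Antitone D)
    (hDD : ∀ i j, ⁅D i, D j⁆ ≤ D (i + j)) {f : Finset ι → H} (hf : f ∈ cubeGroup ι D)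
    (S : Finset ι) (h : ∀ T, T ⊂ S → f T = 1) : f S ∈ D S.card := by
  induction S using Finset.induction_on generalizing D f with
  | empty =>
    clear h
    induction hf using Subgroup.closure_induction with
    | mem f hf =>
      obtain ⟨S, a, ha, rfl⟩ := hf
      rcases S.eq_empty_or_nonempty with rfl | hS
      · simpa [cubeBox] using ha
      · simp [cubeBox, hS.ne_empty]
    | one => exact one_mem _
    | mul x y _ _ hx hy => exact mul_mem hx hy
    | inv x _ hx => exact inv_mem hx
  | insert e S he ih =>
    have hd := (cubeGroup_deriv_mem hD hDD e hf).2
    have := ih (D := fun i => D (i + 1)) (fun i j h => hD (by simpa using h))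
      (fun i j => (hDD _ _).trans (hD (by omega))) hd ?_
    · have h1 : f S = 1 := h S (Finset.ssubset_insert he)
      simpa [Finset.erase_eq_of_notMem he, h1, Finset.card_insert_of_notMem he] using this
    · intro T hT
      have heT : e ∉ T := fun h => he (hT.1 h)
      have h1 : f T = 1 := h T (hT.trans (Finset.ssubset_insert he))
      have h2 : f (insert e T) = 1 := h _ (by
        rw [Finset.ssubset_iff_subset_ne, Finset.insert_subset_insert_iff heT]
        exact ⟨hT.1, fun h => hT.ne (by
          rw [← Finset.erase_insert heT, h, Finset.erase_insert he])⟩)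
      simp [Finset.erase_eq_of_notMem heT, h1, h2]

end Cube

/-! ### Polynomial sequences -/

section Poly

variable {H : Type*} [Group H]

/-- Polynomial sequences in a group with respect to a sequence `D` of subgroups: for each `n` the
function `T ↦ g (card T)` on subsets of an `n`-element set lies in the Host–Kra group of `D`. -/
def polySeq (D : ℕ → Subgroup H) : Subgroup (ℕ → H) where
  carrier := {g | ∀ n, (fun T : Finset (Fin n) => g T.card) ∈ cubeGroup (Fin n) D}
  mul_mem' ha hb n := mul_mem (ha n) (hb n)
  one_mem' _ := one_mem _
  inv_mem' ha n := inv_mem (ha n)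

/-- On the cube of subsets of an `n`-element set, `T ↦ c ^ (card T).choose i` is the product of the
generators attached to `c` and to the `i`-element subsets. -/
theorem pow_choose_mem_polySeq {D : ℕ → Subgroup H} {i : ℕ} {c : H} (hc : c ∈ D i) :
    (fun n => c ^ n.choose i) ∈ polySeq D := by
  intro n
  have key : ∀ U ⊆ Finset.powersetCard i (Finset.univ : Finset (Fin n)),
      (fun T : Finset (Fin n) => c ^ (U.filter (· ⊆ T)).card) ∈ cubeGroup (Fin n) D := by
    intro U
    induction U using Finset.induction_on with
    | empty =>
      intro _
      simp only [Finset.filter_empty, Finset.card_empty, pow_zero]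
      exact one_mem (cubeGroup (Fin n) D)
    | insert S U hS ih =>
      intro hU
      have hcard : S.card = i := (Finset.mem_powersetCard.1 (hU (Finset.mem_insert_self _ _))).2
      have := mul_mem (ih ((Finset.subset_insert _ _).trans hU))
        (cubeBox_mem (D := D) (S := S) (a := c) (by rwa [hcard]))
      convert this using 1
      ext T
      by_cases h : S ⊆ T <;> simp [Finset.filter_insert, cubeBox, h, hS, pow_succ]
  convert key _ subset_rfl using 1
  ext T
  dsimp only
  rw [← Finset.card_powersetCard]
  congr 2
  ext S
  simp [Finset.mem_powersetCard, and_comm]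

theorem pow_mem_polySeq {D : ℕ → Subgroup H} {c : H} (hc : c ∈ D 1) :
    (fun n => c ^ n) ∈ polySeq D := by
  simpa using pow_choose_mem_polySeq hc

theorem const_mem_polySeq {D : ℕ → Subgroup H} {c : H} (hc : c ∈ D 0) :
    (fun _ => c) ∈ polySeq D := by
  simpa using pow_choose_mem_polySeq hc

theorem polySeq_conj_mem {A D : ℕ → Subgroup H} (hD : Antitone D)
    (hAD : ∀ i j, ⁅A i, D j⁆ ≤ D (i + j)) {f g : ℕ → H} (hf : f ∈ polySeq A)
    (hg : g ∈ polySeq D) : f * g * f⁻¹ ∈ polySeq D :=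
  fun n => cubeGroup_conj_mem hD hAD (hf n) (hg n)

/-- The commutator of a polynomial sequence with a constant is polynomial. -/
theorem polySeq_commutator_const_mem {D E : ℕ → Subgroup H} (hE : Antitone E)
    (hDE : ∀ i j, ⁅D i, E j⁆ ≤ E (i + j)) (hDtop : ∀ i, ⁅D i, ⊤⁆ ≤ E i) {g : ℕ → H}
    (hg : g ∈ polySeq D) (h : H) : (fun n => ⁅g n, h⁆) ∈ polySeq E := by
  intro n
  have key : ∀ f ∈ cubeGroup (Fin n) D, (fun T => ⁅f T, h⁆) ∈ cubeGroup (Fin n) E := by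
    intro f hf
    induction hf using Subgroup.closure_induction with
    | mem f hf =>
      obtain ⟨S, a, ha, rfl⟩ := hf
      convert cubeBox_mem (D := E) (S := S)
        (hDtop _ (Subgroup.commutator_mem_commutator ha (Subgroup.mem_top h))) using 1
      ext T
      by_cases hS : S ⊆ T <;> simp [cubeBox, hS]
    | one =>
      simp only [Pi.one_apply, commutatorElement_one_left]
      exact one_mem (cubeGroup (Fin n) E)
    | mul x y hx' _ hx hy =>
      convert mul_mem (cubeGroup_conj_mem hE hDE hx' hy) hx using 1
      ext T
      simp [mul_assoc, commutatorElement_def]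
    | inv x hx' hx =>
      convert cubeGroup_conj_mem hE hDE (inv_mem hx') (inv_mem hx) using 1
      ext T
      simp [mul_assoc, commutatorElement_def]
  exact key _ (hg n)

/-- The leading Taylor coefficient of a polynomial sequence. -/
theorem polySeq_apply_mem {D : ℕ → Subgroup H} (hD : Antitone D)
    (hDD : ∀ i j, ⁅D i, D j⁆ ≤ D (i + j)) {g : ℕ → H} (hg : g ∈ polySeq D) {l : ℕ}
    (h : ∀ n < l, g n = 1) : g l ∈ D l := by
  have := cubeGroup_corner_mem hD hDD (hg l) Finset.univ fun T hT => h _ (by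
    simpa using Finset.card_lt_card hT)
  simpa using this

/-- A weak form of the Hall–Petrescu formula: a polynomial sequence with `g 0 = 1` is
`g 1 ^ n * ∏ c i ^ n.choose i` with `c i ∈ D i` for `2 ≤ i`; at a place `N` at which the last
factors vanish, only the linear one is left. -/
theorem polySeq_apply_eq_pow {D : ℕ → Subgroup H} (hD : Antitone D)
    (hDD : ∀ i j, ⁅D i, D j⁆ ≤ D (i + j)) {g : ℕ → H} (hg : g ∈ polySeq D) (h0 : g 0 = 1)
    {N : ℕ} (hN : ∀ i, 2 ≤ i → ∀ c ∈ D i, c ^ N.choose i = 1) : g N = g 1 ^ N := by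
  have h1 : g 1 ∈ D 1 := polySeq_apply_mem hD hDD hg fun n hn => by
    rwa [Nat.lt_one_iff.1 hn]
  have key : ∀ l, ∃ q ∈ polySeq D, (∀ n < l + 2, q n = g n) ∧ q N = g 1 ^ N := by
    intro l
    induction l with
    | zero =>
      refine ⟨_, pow_mem_polySeq h1, fun n hn => ?_, rfl⟩
      interval_cases n <;> simp [h0]
    | succ l ih =>
      obtain ⟨q, hq, hqg, hqN⟩ := ih
      have hc : (q⁻¹ * g) (l + 2) ∈ D (l + 2) :=
        polySeq_apply_mem hD hDD (mul_mem (inv_mem hq) hg) fun n hn => by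
          simp [hqg n hn]
      refine ⟨_, mul_mem hq (pow_choose_mem_polySeq hc), fun n hn => ?_, ?_⟩
      · rcases Nat.lt_succ_iff_lt_or_eq.1 hn with hn | rfl
        · simp [Nat.choose_eq_zero_of_lt hn, hqg n hn]
        · simp
      · simp only [Pi.mul_apply] at hc ⊢
        rw [hN _ (by omega) _ hc, hqN, mul_one]
  obtain ⟨q, -, hqg, hqN⟩ := key N
  rw [← hqg N (by omega), hqN]

end Poly

/-! ### The filtration of a normal subgroup by iterated commutators -/

section Filtration

variable {H : Type*} [Group H]

/-- The iterated commutators `⁅Y, H, …, H⁆` of a subgroup `Y` with the whole group. -/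
def iteratedCommutator (Y : Subgroup H) : ℕ → Subgroup H
  | 0 => Y
  | i + 1 => ⁅iteratedCommutator Y i, ⊤⁆

variable (Y : Subgroup H)

instance iteratedCommutator_normal [Y.Normal] (i : ℕ) : (iteratedCommutator Y i).Normal := by
  induction i with
  | zero => exact ‹Y.Normal›
  | succ i ih => exact Subgroup.commutator_normal _ _

theorem iteratedCommutator_antitone [Y.Normal] : Antitone (iteratedCommutator Y) :=
  antitone_nat_of_succ_le fun _ => Subgroup.commutator_le_left _ _

theorem iteratedCommutator_le_lowerCentralSeries (i : ℕ) :
    iteratedCommutator Y i ≤ (⊤ : Subgroup H).lowerCentralSeries i := by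
  induction i with
  | zero => exact le_top
  | succ i ih => exact Subgroup.commutator_mono ih le_rfl

/-- The three subgroups lemma modulo a normal subgroup. -/
theorem commutator_commutator_le_of_rotate {A B C N : Subgroup H} [N.Normal]
    (h1 : ⁅⁅B, C⁆, A⁆ ≤ N) (h2 : ⁅⁅C, A⁆, B⁆ ≤ N) : ⁅⁅A, B⁆, C⁆ ≤ N := by
  have key : ∀ P : Subgroup H, P ≤ N ↔ P.map (QuotientGroup.mk' N) = ⊥ := fun P => by
    rw [Subgroup.map_eq_bot_iff, QuotientGroup.ker_mk']
  simp only [key, Subgroup.map_commutator] at h1 h2 ⊢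
  exact Subgroup.commutator_commutator_eq_bot_of_rotate h1 h2

theorem commutator_lowerCentralSeries_iteratedCommutator_le [Y.Normal] (a b : ℕ) :
    ⁅(⊤ : Subgroup H).lowerCentralSeries b, iteratedCommutator Y a⁆ ≤
      iteratedCommutator Y (a + b + 1) := by
  induction b generalizing a with
  | zero => exact (Subgroup.commutator_comm_le _ _).trans le_rfl
  | succ b ih =>
    refine commutator_commutator_le_of_rotate ?_ ?_
    · rw [Subgroup.commutator_comm, Subgroup.commutator_comm ⊤]
      exact (ih (a + 1)).trans (iteratedCommutator_antitone Y (by omega))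
    · refine Subgroup.commutator_mono ?_ le_rfl
      rw [Subgroup.commutator_comm]
      exact ih a

theorem commutator_iteratedCommutator_le [Y.Normal] (a b : ℕ) :
    ⁅iteratedCommutator Y a, iteratedCommutator Y b⁆ ≤ iteratedCommutator Y (a + b + 1) := by
  refine (Subgroup.commutator_mono (iteratedCommutator_le_lowerCentralSeries Y a) le_rfl).trans
    ((commutator_lowerCentralSeries_iteratedCommutator_le Y b a).trans
      (iteratedCommutator_antitone Y (by omega)))

/-- The filtration `⁅Y, j H⁆, ⁅Y, j H⁆, ⁅Y, j + 1 H⁆, …` in degrees `0, 1, 2, …`.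
Degree `0` and degree `1` share the subgroup `⁅Y, j H⁆`, so that for `w ∈ ⁅Y, j H⁆` the sequence
`n ↦ w ^ n` is polynomial; the truncated subtraction `0 - 1 = 0` achieves this. -/
def shiftedFiltration (j i : ℕ) : Subgroup H := iteratedCommutator Y (j + (i - 1))

theorem shiftedFiltration_antitone [Y.Normal] (j : ℕ) : Antitone (shiftedFiltration Y j) :=
  fun _ _ h => iteratedCommutator_antitone Y (by omega)

theorem commutator_shiftedFiltration_le [Y.Normal] {j l : ℕ} (h : l ≤ j + 1) (i i' : ℕ) :
    ⁅shiftedFiltration Y j i, shiftedFiltration Y l i'⁆ ≤ shiftedFiltration Y l (i + i') :=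
  (commutator_iteratedCommutator_le Y _ _).trans (iteratedCommutator_antitone Y (by omega))

theorem commutator_shiftedFiltration_top_le [Y.Normal] (j i : ℕ) :
    ⁅shiftedFiltration Y j i, ⊤⁆ ≤ shiftedFiltration Y (j + 1) i :=
  (iteratedCommutator_antitone Y (by omega) :
    iteratedCommutator Y (j + (i - 1) + 1) ≤ iteratedCommutator Y (j + 1 + (i - 1)))

end Filtration

/-! ### Powers of commutators -/

section Powers

/-- `p ^ n` divides `i * (p ^ n).choose i`, and the `p`-adic valuation `t` of `i` satisfies
`t * (p - 1) ≤ p ^ t - 1 ≤ i - 1`, so that `t ≤ s`. -/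
theorem pow_dvd_choose {p n s i : ℕ} (hp : p.Prime) (hi : 1 ≤ i)
    (h : i - 1 < (s + 1) * (p - 1)) : p ^ (n - s) ∣ (p ^ n).choose i := by
  have hdvd : p ^ n ∣ (p ^ n).choose i * i := by
    obtain ⟨i, rfl⟩ := Nat.exists_eq_add_of_le' hi
    obtain ⟨m, hm⟩ := Nat.exists_eq_add_of_le' (Nat.pos_of_ne_zero (pow_ne_zero n hp.ne_zero))
    rw [hm]
    exact ⟨_, (Nat.add_one_mul_choose_eq m i).symm⟩
  obtain ⟨t, m, hm, rfl⟩ := Nat.exists_eq_pow_mul_and_not_dvd (n := i) (by omega) p hp.ne_one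
  have hts : t ≤ s := by
    by_contra! hts
    have h1 : 1 + t * (p - 1) ≤ p ^ t := by
      have := one_add_mul_le_pow (R := ℤ) (a := p - 1) (by have := hp.two_le; omega) t
      have h2 : ((p - 1 : ℕ) : ℤ) = p - 1 := by have := hp.two_le; omega
      zify
      rw [h2]
      simpa using this
    have h3 : (s + 1) * (p - 1) ≤ t * (p - 1) := Nat.mul_le_mul_right _ hts
    have h4 : p ^ t ≤ p ^ t * m := Nat.le_mul_of_pos_right _ (Nat.pos_of_ne_zero fun h => by
      simp [h] at hm)
    omega
  have hcop : Nat.Coprime (p ^ n) m :=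
    Nat.Coprime.pow_left _ ((Nat.Prime.coprime_iff_not_dvd hp).2 hm)
  rw [← mul_assoc] at hdvd
  have h5 := hcop.dvd_of_dvd_mul_right hdvd
  rcases le_total n s with hns | hns
  · simp [Nat.sub_eq_zero_of_le hns]
  · have h6 : p ^ (n - t) * p ^ t ∣ (p ^ n).choose (p ^ t * m) * p ^ t := by
      rwa [← pow_add, Nat.sub_add_cancel (hts.trans hns)]
    exact (pow_dvd_pow p (by omega)).trans
      (Nat.dvd_of_mul_dvd_mul_right (pow_pos hp.pos t) h6)

variable {H : Type*} [Group H] {p k a : ℕ}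

/-- The exponents `a + (k - j) / (p - 1)` are chosen so that the Taylor coefficients of degree
`i ≥ 2` of a polynomial sequence with linear term in the `j`-th step vanish at
`p ^ (a + (k - j) / (p - 1))`: passing to `j + i - 1` the exponent drops by at least the
`p`-adic valuation of `i`. -/
theorem pow_choose_eq_one (hp : p.Prime) (Y : Subgroup H)
    (hbot : iteratedCommutator Y (k + 1) = ⊥) [Y.Normal] {j i : ℕ} (hi : 1 ≤ i)
    (hpow : ∀ c ∈ iteratedCommutator Y (j + (i - 1)),
      c ^ p ^ (a + (k - (j + (i - 1))) / (p - 1)) = 1) :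
    ∀ c ∈ iteratedCommutator Y (j + (i - 1)),
      c ^ (p ^ (a + (k - j) / (p - 1))).choose i = 1 := by
  intro c hc
  rcases lt_or_ge k (j + (i - 1)) with hk | hk
  · have : c ∈ (⊥ : Subgroup H) := hbot ▸ iteratedCommutator_antitone Y hk hc
    rw [Subgroup.mem_bot.1 this, one_pow]
  · have hp1 : 0 < p - 1 := by have := hp.two_le; omega
    have hdvd := pow_dvd_choose (n := a + (k - j) / (p - 1)) (s := (i - 1) / (p - 1)) hp hi
      (by rw [mul_comm]; exact Nat.lt_mul_div_succ _ hp1)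
    have hle : (k - (j + (i - 1))) / (p - 1) + (i - 1) / (p - 1) ≤ (k - j) / (p - 1) :=
      Nat.div_add_div_le_add_div.trans (Nat.div_le_div_right (by omega))
    have hle' : a + (k - (j + (i - 1))) / (p - 1) ≤
        a + (k - j) / (p - 1) - (i - 1) / (p - 1) := by omega
    obtain ⟨m, hm⟩ := (pow_dvd_pow p hle').trans hdvd
    rw [hm, pow_mul, hpow c hc, one_pow]

/-- Each element of `⁅Y, j H⁆` is the value at `1` of a polynomial sequence obtained by taking
commutators of products of sequences `n ↦ c ^ n`; centrality of `c ^ N` makes it trivial at `N`. -/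
theorem exists_polySeq_of_mem (Y : Subgroup H) [Y.Normal] {N : ℕ} (S : Set H)
    (hY : Y = Subgroup.closure S) (hN : ∀ c ∈ S, c ^ N ∈ Subgroup.center H) (j : ℕ) :
    ∀ m ∈ iteratedCommutator Y j, ∃ g ∈ polySeq (shiftedFiltration Y j),
      g 0 = 1 ∧ g 1 = m ∧ g N ∈ Subgroup.center H ∧ (1 ≤ j → g N = 1) := by
  intro m hm
  induction j generalizing m with
  | zero =>
    have hm' : m ∈ Subgroup.closure S := hY ▸ hm
    induction hm' using Subgroup.closure_induction with
    | mem c hc => exact ⟨_, pow_mem_polySeq hm, by simp, by simp, hN c hc, by simp⟩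
    | one => exact ⟨1, one_mem _, rfl, rfl, one_mem _, by simp⟩
    | mul x y hx' hy' hx hy =>
      obtain ⟨f, hf, hf0, hf1, hfN, -⟩ := hx (by rw [← hY] at hx'; exact hx')
      obtain ⟨g, hg, hg0, hg1, hgN, -⟩ := hy (by rw [← hY] at hy'; exact hy')
      exact ⟨f * g, mul_mem hf hg, by simp [hf0, hg0], by simp [hf1, hg1], mul_mem hfN hgN,
        by simp⟩
    | inv x hx' hx =>
      obtain ⟨f, hf, hf0, hf1, hfN, -⟩ := hx (by rw [← hY] at hx'; exact hx')
      exact ⟨f⁻¹, inv_mem hf, by simp [hf0], by simp [hf1], inv_mem hfN, by simp⟩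
  | succ j ih =>
    suffices ∃ g ∈ polySeq (shiftedFiltration Y (j + 1)), g 0 = 1 ∧ g 1 = m ∧ g N = 1 by
      obtain ⟨g, hg, h0, h1, h2⟩ := this
      exact ⟨g, hg, h0, h1, h2 ▸ one_mem _, fun _ => h2⟩
    induction hm using Subgroup.closure_induction with
    | mem c hc =>
      obtain ⟨w, hw, h, -, rfl⟩ := hc
      obtain ⟨g, hg, h0, h1, h2, -⟩ := ih w hw
      refine ⟨_, polySeq_commutator_const_mem (shiftedFiltration_antitone Y (j + 1))
        (commutator_shiftedFiltration_le Y le_rfl) (commutator_shiftedFiltration_top_le Y j) hg h,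
        by simp [h0], by simp [h1], ?_⟩
      exact commutatorElement_eq_one_iff_mul_comm.2 (Subgroup.mem_center_iff.1 h2 h).symm
    | one => exact ⟨1, one_mem _, rfl, rfl, rfl⟩
    | mul x y _ _ hx hy =>
      obtain ⟨f, hf, hf0, hf1, hfN⟩ := hx
      obtain ⟨g, hg, hg0, hg1, hgN⟩ := hy
      exact ⟨f * g, mul_mem hf hg, by simp [hf0, hg0], by simp [hf1, hg1], by simp [hfN, hgN]⟩
    | inv x _ hx =>
      obtain ⟨f, hf, hf0, hf1, hfN⟩ := hx
      exact ⟨f⁻¹, inv_mem hf, by simp [hf0], by simp [hf1], by simp [hfN]⟩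

/-- Downward induction on `j`: an element `m` of `⁅Y, j H⁆` is `g 1` for a polynomial sequence `g`
with `g N = 1`, and by induction the Taylor coefficients of `g` of degree at least `2` contribute
nothing to `g N`, which leaves `m ^ N = 1`. -/
theorem pow_eq_one_of_mem_iteratedCommutator (hp : p.Prime) (Y : Subgroup H) [Y.Normal] (S : Set H)
    (hY : Y = Subgroup.closure S) (hS : ∀ c ∈ S, c ^ p ^ a ∈ Subgroup.center H)
    (hbot : iteratedCommutator Y (k + 1) = ⊥) {j : ℕ} (hj : 1 ≤ j) :
    ∀ m ∈ iteratedCommutator Y j, m ^ p ^ (a + (k - j) / (p - 1)) = 1 := by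
  induction hd : k + 1 - j using Nat.strong_induction_on generalizing j with
  | _ d ih =>
  intro m hm
  rcases lt_or_ge k j with hk | hk
  · have : m ∈ (⊥ : Subgroup H) := hbot ▸ iteratedCommutator_antitone Y hk hm
    rw [Subgroup.mem_bot.1 this, one_pow]
  obtain ⟨g, hg, h0, rfl, -, hN⟩ := exists_polySeq_of_mem (N := p ^ (a + (k - j) / (p - 1))) Y S hY
    (fun c hc => by rw [pow_add, pow_mul]; exact pow_mem (hS c hc) _) j m hm
  rw [← polySeq_apply_eq_pow (shiftedFiltration_antitone Y j)
    (commutator_shiftedFiltration_le Y (Nat.le_succ j)) hg h0, hN hj]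
  exact fun i hi => pow_choose_eq_one hp Y hbot (by omega) (ih _ (by omega) (by omega) rfl)

/-- In a group of class at most `k + 1`, if `y ^ p ^ a` is central then
`x ^ p ^ (a + (k - 1) / (p - 1))` commutes with `y`. -/
theorem commute_pow_of_pow_mem_center (hp : p.Prime)
    (hH : (⊤ : Subgroup H).lowerCentralSeries (k + 1) = ⊥) {y : H}
    (hy : y ^ p ^ a ∈ Subgroup.center H) (x : H) :
    Commute y (x ^ p ^ (a + (k - 1) / (p - 1))) := by
  set Y := Subgroup.normalClosure {y}
  have hYS : Y = Subgroup.closure (Group.conjugatesOfSet {y}) := rfl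
  have hS : ∀ c ∈ Group.conjugatesOfSet {y}, c ^ p ^ a ∈ Subgroup.center H := by
    intro c hc
    simp only [Group.mem_conjugatesOfSet_iff, Set.mem_singleton_iff, exists_eq_left] at hc
    obtain ⟨h, rfl⟩ := isConj_iff.1 hc
    rw [conj_pow]
    exact Subgroup.Normal.conj_mem inferInstance _ hy h
  have hbot : iteratedCommutator Y (k + 1) = ⊥ :=
    le_bot_iff.1 (hH ▸ iteratedCommutator_le_lowerCentralSeries Y (k + 1))
  have hpow := fun {j : ℕ} (hj : 1 ≤ j) =>
    pow_eq_one_of_mem_iteratedCommutator (k := k) (j := j) hp Y _ hYS hS hbot hj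
  have hanti := iteratedCommutator_antitone Y
  have hDD : ∀ i j, ⁅iteratedCommutator Y i, iteratedCommutator Y j⁆ ≤
      iteratedCommutator Y (i + j) :=
    fun i j => (commutator_iteratedCommutator_le Y i j).trans (hanti (Nat.le_succ _))
  have hyY : y ∈ iteratedCommutator Y 0 := Subgroup.subset_normalClosure rfl
  -- `n ↦ x ^ n` is polynomial for `A`, and conjugation by such sequences preserves the polynomial
  -- sequences of `iteratedCommutator Y`, although `x` need not lie in `Y`.
  let A : ℕ → Subgroup H := fun i => if i ≤ 1 then ⊤ else ⊥
  have hx : (fun n => x ^ n) ∈ polySeq A := pow_mem_polySeq (by simp [A])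
  have hA : ∀ i j, ⁅A i, iteratedCommutator Y j⁆ ≤ iteratedCommutator Y (i + j) := by
    intro i j
    by_cases hi : i ≤ 1
    · rw [Subgroup.commutator_comm]
      exact (Subgroup.commutator_mono le_rfl le_top).trans (hanti (by omega : i + j ≤ j + 1))
    · simp [A, hi]
  have hg : (fun n => ⁅y, x ^ n⁆) ∈ polySeq (iteratedCommutator Y) := by
    have hc := const_mem_polySeq hyY
    convert mul_mem hc (polySeq_conj_mem hanti hA hx (inv_mem hc)) using 1
    ext n
    simp [commutatorElement_def, mul_assoc]
  rw [← commutatorElement_eq_one_iff_commute]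
  have := polySeq_apply_eq_pow hanti hDD hg (by simp) (N := p ^ (a + (k - 1) / (p - 1))) ?_
  · rw [this]
    exact hpow le_rfl _ (Subgroup.commutator_mem_commutator hyY (Subgroup.mem_top (x ^ 1)))
  · intro i hi c hc
    have h1 : 1 + (i - 1) = i := by omega
    refine pow_choose_eq_one (j := 1) hp Y hbot (by omega) (hpow (by omega)) c ?_
    rwa [h1]

end Powers

/-! ### Capable groups -/

/-- If `H / Z(H)` has class at most `k` then `H` has class at most `k + 1`. -/
theorem lowerCentralSeries_succ_eq_bot_of_ker_le_center {G H : Type*} [Group G] [Group H]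
    (f : H →* G) (hker : f.ker ≤ Subgroup.center H) {k : ℕ}
    (hclass : (⊤ : Subgroup G).lowerCentralSeries k = ⊥) :
    (⊤ : Subgroup H).lowerCentralSeries (k + 1) = ⊥ := by
  rw [Subgroup.lowerCentralSeries_succ, Subgroup.commutator_eq_bot_iff_le_centralizer,
    Subgroup.coe_top, Subgroup.centralizer_univ]
  refine le_trans ?_ hker
  rw [← Subgroup.map_eq_bot_iff, Subgroup.map_lowerCentralSeries, ← le_bot_iff, ← hclass]
  exact Subgroup.lowerCentralSeries_mono k le_top

/-- If lifts of generators of `G` commute with `z`, then `z` is in the kernel. -/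
theorem mem_center_of_commute_lifts {G H ι : Type*} [Group G] [Group H] (f : H →* G)
    (hker : f.ker = Subgroup.center H) (h : ι → H)
    (hgen : Subgroup.closure (Set.range fun i => f (h i)) = ⊤) {z : H}
    (hz : ∀ i, Commute (h i) z) : z ∈ Subgroup.center H := by
  have hle : f.ker ≤ Subgroup.centralizer {z} := by
    rw [hker]
    exact Subgroup.center_le_centralizer _
  have hmap : (Subgroup.centralizer {z}).map f = ⊤ := by
    rw [eq_top_iff, ← hgen, Subgroup.closure_le]
    rintro _ ⟨i, rfl⟩
    exact ⟨h i, Subgroup.mem_centralizer_singleton_iff.2 (hz i).eq, rfl⟩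
  have htop : Subgroup.centralizer {z} = ⊤ := by
    rw [← Subgroup.comap_map_eq_self hle, hmap, Subgroup.comap_top]
  refine Subgroup.mem_center_iff.2 fun g => ?_
  exact Subgroup.mem_centralizer_singleton_iff.1 (htop ▸ Subgroup.mem_top g)

/-- A group with cyclic central quotient is abelian, so that this quotient is trivial. -/
theorem IsCapableGroup.not_isCyclic {G : Type u} [Group G] [Nontrivial G]
    (hcap : IsCapableGroup.{u, v} G) : ¬ IsCyclic G := by
  intro hG
  obtain ⟨H, _, ⟨e⟩⟩ := hcap
  have hcyc : IsCyclic (H ⧸ Subgroup.center H) := isCyclic_of_surjective e.toMonoidHom e.surjective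
  have hcomm := isMulCommutative_of_isCyclic_quotient_center_self (G := H)
  have : Subsingleton (H ⧸ Subgroup.center H) := by
    rw [QuotientGroup.subsingleton_iff]
    exact eq_top_iff.2 fun g _ => Subgroup.mem_center_iff.2 fun h => hcomm.is_comm.comm h g
  exact not_subsingleton G e.injective.subsingleton

theorem theorem3p12 {G : Type u} [Group G] [Nontrivial G]
    (p : ℕ) (hp : p.Prime) (hG : IsPGroup p G)
    (k : ℕ) (hk : 1 ≤ k) (hclass : (⊤ : Subgroup G).lowerCentralSeries k = ⊥)
    (r : ℕ) (x : Fin r → G) (hx : Subgroup.closure (Set.range x) = ⊤)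
    (α : Fin r → ℕ) (hα : ∀ i, orderOf (x i) = p ^ α i) (hmono : Monotone α)
    (hcap : IsCapableGroup.{u, v} G) :
    ∃ hr : 1 < r,
      α ⟨r - 1, by omega⟩ ≤ α ⟨r - 2, by omega⟩ + (k - 1) / (p - 1) ∧
      (k < p → α ⟨r - 1, by omega⟩ = α ⟨r - 2, by omega⟩) := by
  have hr : 1 < r := by
    by_contra! hr
    refine hcap.not_isCyclic ?_
    have hsub : (Set.range x).Subsingleton := by
      have : Subsingleton (Fin r) := Fin.subsingleton_iff_le_one.2 hr
      exact Set.subsingleton_range x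
    rcases hsub.eq_empty_or_singleton with h | ⟨g, h⟩
    · rw [h, Subgroup.closure_empty] at hx
      exact absurd hx bot_ne_top
    · rw [h, ← Subgroup.zpowers_eq_closure] at hx
      exact ⟨g, fun y => Subgroup.mem_zpowers_iff.1 (by rw [hx]; exact Subgroup.mem_top y)⟩
  have hle : α ⟨r - 1, by omega⟩ ≤ α ⟨r - 2, by omega⟩ + (k - 1) / (p - 1) := by
    obtain ⟨H, _, ⟨e⟩⟩ := hcap
    let f : H →* G := e.symm.toMonoidHom.comp (QuotientGroup.mk' (Subgroup.center H))
    have hf : Function.Surjective f :=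
      e.symm.surjective.comp (QuotientGroup.mk'_surjective (Subgroup.center H))
    have hker : f.ker = Subgroup.center H := by
      ext z
      simp [f]
    have hH := lowerCentralSeries_succ_eq_bot_of_ker_le_center f hker.le hclass
    choose h hh using fun i => hf (x i)
    set a := α ⟨r - 2, by omega⟩
    set z := h ⟨r - 1, by omega⟩ ^ p ^ (a + (k - 1) / (p - 1)) with hz
    have hzc : z ∈ Subgroup.center H := by
      refine mem_center_of_commute_lifts f hker h (by simpa [hh] using hx) fun i => ?_
      rcases lt_or_ge (i : ℕ) (r - 1) with hi | hi
      · refine commute_pow_of_pow_mem_center hp hH ?_ _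
        rw [← hker, MonoidHom.mem_ker, map_pow, hh, ← orderOf_dvd_iff_pow_eq_one, hα]
        exact pow_dvd_pow p (hmono (Fin.le_def.2 (by simp; omega)))
      · have : i = ⟨r - 1, by omega⟩ := Fin.ext (by simp; omega)
        rw [this]
        exact (Commute.refl _).pow_right _
    rw [← hker, MonoidHom.mem_ker, hz, map_pow, hh, ← orderOf_dvd_iff_pow_eq_one, hα] at hzc
    exact (Nat.pow_dvd_pow_iff_le_right hp.one_lt).1 hzc
  refine ⟨hr, hle, fun hkp => le_antisymm ?_ (hmono (Fin.le_def.2 (by simp; omega)))⟩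
  rwa [Nat.div_eq_of_lt (by omega), add_zero] at hle
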